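/- An o-minimal structure on the real field is a sequence $\mathcal D=(\mathcal D_n)_{n\in\mathbb N}$, where $\mathcal D_n$ is a collection of subsets of $\mathbb R^n$ (the definable sets), such that: each $\mathcal D_n$ is closed under complements and finite unions; if $A\in\mathcal D_n$ then $A\times\mathbb R,\ \mathbb R\times A\in\mathcal D_{n+1}$; if $A\in\mathcal D_{n+1}$ then the projection of $A$ to the first $n$ coordinates is in $\mathcal D_n$; $\mathcal D_n$ contains the zero set of every polynomial in $\mathbb R[X_1,\dots,X_n]$; and each set in $\mathcal D_1$ is a finite union of intervals and points. A map is definable if its graph is definable. Fix an o-minimal structure on the real field. Let $U\subseteq\mathbb R^d$ be open, let $f:U\to\mathbb R$ be a definable $C^2$ function, and let $c\in U$ with $\nabla f(c)=0$. Let $\varepsilon>0$ and let $\gamma:[0,\varepsilon)\to\mathbb R^d$ be a definable tangency arc of $f$ relative to $c$, that is, a definable continuous curve with $\gamma(0)=c$ such that for every $t\in(0,\varepsilon)$ one has $\gamma(t)\in U$, $\gamma(t)\ne c$ and $\nabla f(\gamma(t))=\lambda\,(\gamma(t)-c)$ for some $\lambda\in\mathbb R$. Suppose that $\gamma$ is parameterized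 by arc length in the sense that $\|\gamma(t)-c\|=t$ for all $t\in[0,\varepsilon)$ (Euclidean norm). Then the one-sided derivative $$\dot\gamma(0)=\lim_{t\to0^+}\frac{\gamma(t)-c}{t}$$ exists and is an eigenvector of the Hessian $\nabla^2 f(c)$ (so $\gamma$ approaches $c$ tangentially to an eigenspace of $\nabla^2f(c)$). Moreover, for $r>0$ let $m(r)$ and $M(r)$ denote the minimum and the maximum of $f$ on $\{x\in U : \|x-c\|=r\}$, where they exist. If $f(\gamma(r))=m(r)$ (resp. $f(\gamma(r))=M(r)$) for all $r\in(0,\varepsilon)$ (in particular the minimum, resp. maximum, exists), then $\dot\gamma(0)$ is an eigenvector of $\nabla^2 f(c)$ for its minimal (resp. maximal) eigenvalue. -/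

import Mathlib

noncomputable section

/-- An o-minimal structure on the real field `(ℝ, +, ·)`: for every `n`, a collection of subsets
of `ℝⁿ`, called the definable sets. -/
structure OMinimalStructure where
  /-- The definable subsets of `ℝⁿ`. -/
  definable : (n : ℕ) → Set (Set (Fin n → ℝ))
  compl_mem : ∀ {n : ℕ} {A : Set (Fin n → ℝ)}, A ∈ definable n → Aᶜ ∈ definable n
  union_mem : ∀ {n : ℕ} {A B : Set (Fin n → ℝ)},
    A ∈ definable n → B ∈ definable n → A ∪ B ∈ definable n
  /-- `A × ℝ` is definable. -/
  prod_line_mem : ∀ {n : ℕ} {A : Set (Fin n → ℝ)}, A ∈ definable n →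
    {p : Fin (n + 1) → ℝ | Fin.init p ∈ A} ∈ definable (n + 1)
  /-- `ℝ × A` is definable. -/
  line_prod_mem : ∀ {n : ℕ} {A : Set (Fin n → ℝ)}, A ∈ definable n →
    {p : Fin (n + 1) → ℝ | Fin.tail p ∈ A} ∈ definable (n + 1)
  /-- The projection of `A ⊆ ℝⁿ⁺¹` to the first `n` coordinates is definable. -/
  proj_mem : ∀ {n : ℕ} {A : Set (Fin (n + 1) → ℝ)}, A ∈ definable (n + 1) →
    (fun p : Fin (n + 1) → ℝ => (Fin.init p : Fin n → ℝ)) '' A ∈ definable n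
  zeroLocus_mem : ∀ {n : ℕ} (P : MvPolynomial (Fin n) ℝ),
    {x : Fin n → ℝ | MvPolynomial.eval x P = 0} ∈ definable n
  /-- Definable subsets of the line are finite unions of intervals and points. The order-connected
  subsets of `ℝ` are the intervals of all kinds, including points and the empty set. -/
  finite_union : ∀ {A : Set (Fin 1 → ℝ)}, A ∈ definable 1 →
    ∃ F : Set (Set ℝ), F.Finite ∧ (∀ I ∈ F, I.OrdConnected) ∧ A = {p | p 0 ∈ ⋃₀ F}

/-- A map `F : A → ℝᵐ`, `A ⊆ ℝⁿ`, is definable if its graph `{(x, F x) | x ∈ A}` is a definable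
subset of `ℝⁿ⁺ᵐ`. -/
def OMinimalStructure.DefinableMap (S : OMinimalStructure) {n m : ℕ} (A : Set (Fin n → ℝ))
    (F : (Fin n → ℝ) → (Fin m → ℝ)) : Prop :=
  (fun x => Fin.append x (F x)) '' A ∈ S.definable (n + m)

/-- Definability of a real function `f : U → ℝ` on a subset `U` of Euclidean space. -/
def OMinimalStructure.DefinableFunction (S : OMinimalStructure) {d : ℕ}
    (U : Set (EuclideanSpace ℝ (Fin d))) (f : EuclideanSpace ℝ (Fin d) → ℝ) : Prop :=
  S.DefinableMap (m := 1) {x : Fin d → ℝ | WithLp.toLp 2 x ∈ U}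
    (fun x _ => f (WithLp.toLp 2 x))

/-- Definability of a curve `γ : I → ℝᵈ`, `I ⊆ ℝ`. -/
def OMinimalStructure.DefinableCurve (S : OMinimalStructure) {d : ℕ}
    (I : Set ℝ) (γ : ℝ → EuclideanSpace ℝ (Fin d)) : Prop :=
  S.DefinableMap (n := 1) {s : Fin 1 → ℝ | s 0 ∈ I} (fun s => WithLp.ofLp (γ (s 0)))

/-- The tangency set of `f : U → ℝ` relative to `c`: the points `x ≠ c` of `U` at which the
gradient of `f` is a multiple of `x - c`. -/
def tangencySet {d : ℕ} (U : Set (EuclideanSpace ℝ (Fin d)))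
    (f : EuclideanSpace ℝ (Fin d) → ℝ) (c : EuclideanSpace ℝ (Fin d)) :
    Set (EuclideanSpace ℝ (Fin d)) :=
  {x | x ∈ U ∧ x ≠ c ∧ ∃ l : ℝ, gradient f x = l • (x - c)}

/-- A tangency arc `γ : [0, ε) → ℝᵈ` of `f : U → ℝ` relative to `c`. -/
structure IsTangencyArc {d : ℕ} (U : Set (EuclideanSpace ℝ (Fin d)))
    (f : EuclideanSpace ℝ (Fin d) → ℝ) (c : EuclideanSpace ℝ (Fin d)) (ε : ℝ)
    (γ : ℝ → EuclideanSpace ℝ (Fin d)) : Prop where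
  continuousOn : ContinuousOn γ (Set.Ico 0 ε)
  map_zero : γ 0 = c
  mem_tangencySet : ∀ t ∈ Set.Ioo 0 ε, γ t ∈ tangencySet U f c

/-- The arc is parameterized by arc length, in the sense that `‖γ t - c‖ = t` on `[0, ε)`. -/
def ParameterizedByArcLength {d : ℕ} (c : EuclideanSpace ℝ (Fin d)) (ε : ℝ)
    (γ : ℝ → EuclideanSpace ℝ (Fin d)) : Prop :=
  ∀ t ∈ Set.Ico 0 ε, ‖γ t - c‖ = t

/-- The arc gives `m(r)`: for every `r ∈ (0, ε)`, the value `f (γ r)` is the minimum of `f` over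
the points of its domain `U` on the sphere of radius `r` centered at `c`. -/
def GivesMin {d : ℕ} (U : Set (EuclideanSpace ℝ (Fin d)))
    (f : EuclideanSpace ℝ (Fin d) → ℝ) (c : EuclideanSpace ℝ (Fin d)) (ε : ℝ)
    (γ : ℝ → EuclideanSpace ℝ (Fin d)) : Prop :=
  ∀ r ∈ Set.Ioo 0 ε, IsLeast (f '' (Metric.sphere c r ∩ U)) (f (γ r))

/-- The arc gives `M(r)`: for every `r ∈ (0, ε)`, the value `f (γ r)` is the maximum of `f` over
the points of its domain `U` on the sphere of radius `r` centered at `c`. -/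
def GivesMax {d : ℕ} (U : Set (EuclideanSpace ℝ (Fin d)))
    (f : EuclideanSpace ℝ (Fin d) → ℝ) (c : EuclideanSpace ℝ (Fin d)) (ε : ℝ)
    (γ : ℝ → EuclideanSpace ℝ (Fin d)) : Prop :=
  ∀ r ∈ Set.Ioo 0 ε, IsGreatest (f '' (Metric.sphere c r ∩ U)) (f (γ r))

/-- The Hessian `∇²f(c)`, as the linear operator on `ℝᵈ` that is the derivative of the gradient. -/
def hessian {d : ℕ} (f : EuclideanSpace ℝ (Fin d) → ℝ) (c : EuclideanSpace ℝ (Fin d)) :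
    Module.End ℝ (EuclideanSpace ℝ (Fin d)) :=
  (fderiv ℝ (gradient f) c).toLinearMap

end

open Filter Topology Set

/-! ### Definable sets, and the dichotomy at the right of zero -/

namespace OMinimalStructure

variable (S : OMinimalStructure)

/-! O-minimality is needed only for the limit of the unit secants `t⁻¹ • (γ t - c)` to exist: each
coordinate lies eventually on one side of any level, so it cannot oscillate
(`exists_tendsto_secant`). The rest is calculus. Since `∇f(c) = 0`, the rescaled gradient along `γ`
tends to `H v`, with `H` the Hessian and `v` the limit; being radial, it forces `H v` to be parallel
to `v` (`fderiv_gradient_apply_eq_smul`). By Taylor, `(f (γ t) - f c) / t ^ 2` tends to half the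
eigenvalue (`tendsto_secondOrder_secant`); comparing with rays along other eigenvectors shows that
it is extremal. -/

theorem inter_mem {n : ℕ} {A B : Set (Fin n → ℝ)} (hA : A ∈ S.definable n)
    (hB : B ∈ S.definable n) : A ∩ B ∈ S.definable n := by
  have h := S.compl_mem (S.union_mem (S.compl_mem hA) (S.compl_mem hB))
  rwa [compl_union, compl_compl, compl_compl] at h

/-- The positivity set of a polynomial is definable. -/
theorem posLocus_mem {n : ℕ} (P : MvPolynomial (Fin n) ℝ) :
    {x : Fin n → ℝ | 0 < MvPolynomial.eval x P} ∈ S.definable n := by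
  -- `P x > 0` iff `P x * y ^ 2 = 1` for some real `y`.
  have h := S.proj_mem (S.zeroLocus_mem
    (MvPolynomial.rename Fin.castSucc P * MvPolynomial.X (Fin.last n) ^ 2 - 1))
  convert h using 1
  ext x
  simp only [mem_ofPred_eq, mem_image, map_sub, map_mul, map_pow, map_one,
    MvPolynomial.eval_rename, MvPolynomial.eval_X]
  constructor
  · intro hx
    refine ⟨Fin.snoc x (√(MvPolynomial.eval x P))⁻¹, ?_, Fin.init_snoc _ _⟩
    have hx' : (Fin.snoc x (√(MvPolynomial.eval x P))⁻¹ : Fin (n + 1) → ℝ) ∘ Fin.castSucc = x := by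
      ext i
      simp
    rw [hx', Fin.snoc_last, inv_pow, Real.sq_sqrt hx.le, mul_inv_cancel₀ hx.ne', sub_self]
  · rintro ⟨p, hp, rfl⟩
    have hp' : MvPolynomial.eval (Fin.init p) P * p (Fin.last n) ^ 2 = 1 := sub_eq_zero.mp hp
    exact pos_of_mul_pos_left (hp' ▸ one_pos) (sq_nonneg _)

/-- The projection to the first coordinates of a definable set is definable. -/
theorem image_castAdd_mem {n m : ℕ} {A : Set (Fin (n + m) → ℝ)} (hA : A ∈ S.definable (n + m)) :
    (fun (p : Fin (n + m) → ℝ) (i : Fin n) => p (Fin.castAdd m i)) '' A ∈ S.definable n := by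
  induction m with
  | zero => simpa using hA
  | succ m ih =>
    have h := ih (S.proj_mem hA)
    rw [image_image] at h
    exact h

/-- A definable subset of the line or its complement contains an interval `(0, δ)`. -/
theorem eventually_mem_or_eventually_notMem {A : Set (Fin 1 → ℝ)} (hA : A ∈ S.definable 1) :
    (∀ᶠ t : ℝ in 𝓝[>] 0, (fun _ => t) ∈ A) ∨ ∀ᶠ t : ℝ in 𝓝[>] 0, (fun _ => t) ∉ A := by
  obtain ⟨F, hF, hconn, rfl⟩ := S.finite_union hA
  -- An interval accumulating at `0` from the right contains some `(0, t₀)`; otherwise finiteness of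
  -- `F` lets all its members be avoided at once.
  by_cases h : ∃ I ∈ F, ∃ᶠ t : ℝ in 𝓝[>] 0, t ∈ I
  · obtain ⟨I, hI, hfreq⟩ := h
    left
    obtain ⟨t₀, ht₀I, ht₀⟩ := (hfreq.and_eventually self_mem_nhdsWithin).exists
    filter_upwards [Ioo_mem_nhdsGT ht₀] with t ht
    obtain ⟨s, hsI, hs⟩ := (hfreq.and_eventually (Ioo_mem_nhdsGT ht.1)).exists
    exact ⟨I, hI, (hconn I hI).out hsI ht₀I ⟨hs.2.le, ht.2.le⟩⟩
  · push Not at h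
    right
    filter_upwards [(eventually_all_finite hF).2 h] with t ht
    rintro ⟨I, hI, htI⟩
    exact ht I hI htI

end OMinimalStructure

/-! ### Convergence of secants -/

section Curve

variable {d : ℕ}

/-- The secant direction at `0` of a definable curve, if bounded, converges. -/
theorem OMinimalStructure.DefinableCurve.exists_tendsto_secant {S : OMinimalStructure}
    {γ : ℝ → EuclideanSpace ℝ (Fin d)} {ε : ℝ} (hε : 0 < ε)
    (hγ : S.DefinableCurve (Ico 0 ε) γ) (c : EuclideanSpace ℝ (Fin d)) {C : ℝ}
    (hC : ∀ t ∈ Ioo 0 ε, ‖t⁻¹ • (γ t - c)‖ ≤ C) :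
    ∃ v, Tendsto (fun t : ℝ => t⁻¹ • (γ t - c)) (𝓝[>] 0) (𝓝 v) := by
  have hdich (i : Fin d) (q : ℝ) : (∀ᶠ t : ℝ in 𝓝[>] 0, q < (t⁻¹ • (γ t - c)) i) ∨
      ∀ᶠ t : ℝ in 𝓝[>] 0, (t⁻¹ • (γ t - c)) i ≤ q := by
    -- For `t > 0` the denominator clears, so the comparison with `q` is a polynomial inequality on
    -- the graph of `γ`.
    have hpos := S.posLocus_mem (n := 1 + d) (MvPolynomial.X (Fin.natAdd 1 i) -
      MvPolynomial.C (c i) - MvPolynomial.C q * MvPolynomial.X (Fin.castAdd d 0))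
    obtain ⟨A, hA, hmem⟩ : ∃ A ∈ S.definable 1, ∀ t ∈ Ioo 0 ε,
        ((fun _ => t) ∈ A ↔ q < (t⁻¹ • (γ t - c)) i) := by
      refine ⟨_, S.image_castAdd_mem (S.inter_mem hγ hpos), fun t ht => ?_⟩
      have hdiv : q < (t⁻¹ • (γ t - c)) i ↔ 0 < γ t i - c i - q * t := by
        rw [PiLp.smul_apply, PiLp.sub_apply, smul_eq_mul, inv_mul_eq_div, lt_div_iff₀ ht.1, sub_pos]
      rw [hdiv]
      constructor
      · rintro ⟨p, ⟨⟨s, -, rfl⟩, hp⟩, hpt⟩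
        have hs : s 0 = t := by simpa using congrFun hpt 0
        simpa [hs] using hp
      · intro h
        refine ⟨Fin.append (fun _ => t) (WithLp.ofLp (γ t)),
          ⟨⟨fun _ => t, ⟨ht.1.le, ht.2⟩, rfl⟩, ?_⟩, ?_⟩
        · simpa using h
        · ext j
          simp
    refine (S.eventually_mem_or_eventually_notMem hA).imp (fun h => ?_) fun h => ?_
    · filter_upwards [h, Ioo_mem_nhdsGT hε] with t h ht
      exact (hmem t ht).1 h
    · filter_upwards [h, Ioo_mem_nhdsGT hε] with t h ht
      exact not_lt.1 fun hlt => h ((hmem t ht).2 hlt)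
  have hbdd (i : Fin d) : ∀ᶠ t : ℝ in 𝓝[>] 0, |(t⁻¹ • (γ t - c)) i| ≤ C := by
    filter_upwards [Ioo_mem_nhdsGT hε] with t ht
    exact (PiLp.norm_apply_le (t⁻¹ • (γ t - c)) i).trans (hC t ht)
  have hlim (i : Fin d) : ∃ x, Tendsto (fun t : ℝ => (t⁻¹ • (γ t - c)) i) (𝓝[>] 0) (𝓝 x) := by
    refine tendsto_of_no_upcrossings dense_univ ?_
      (isBoundedUnder_of_eventually_le ((hbdd i).mono fun t h => (abs_le.1 h).2))
      (isBoundedUnder_of_eventually_ge ((hbdd i).mono fun t h => (abs_le.1 h).1))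
    rintro a - b - hab ⟨ha, hb⟩
    rcases hdich i a with h | h
    · exact ha (h.mono fun t ht => not_lt.2 ht.le)
    · exact hb (h.mono fun t ht => not_lt.2 (ht.trans hab.le))
  choose x hx using hlim
  refine ⟨WithLp.toLp 2 x, ?_⟩
  have h := ((PiLp.continuous_toLp 2 fun _ : Fin d => ℝ).tendsto x).comp (tendsto_pi_nhds.2 hx)
  exact h

end Curve

/-! ### Second-order calculus at a critical point -/

section SecondOrder

variable {E : Type*} [NormedAddCommGroup E] [InnerProductSpace ℝ E] [CompleteSpace E]
  {f : E → ℝ} {c : E}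

theorem ContDiffAt.differentiableAt_gradient (hf : ContDiffAt ℝ 2 f c) :
    DifferentiableAt ℝ (gradient f) c :=
  (InnerProductSpace.toDual ℝ E).symm.differentiableAt.comp c
    ((hf.fderiv_right (m := 1) (by norm_num)).differentiableAt one_ne_zero)

theorem inner_fderiv_gradient (hf : ContDiffAt ℝ 2 f c) (x y : E) :
    inner ℝ (fderiv ℝ (gradient f) c x) y = fderiv ℝ (fderiv ℝ f) c x y := by
  have hd : DifferentiableAt ℝ (fderiv ℝ f) c :=
    (hf.fderiv_right (m := 1) (by norm_num)).differentiableAt one_ne_zero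
  have h : (fun z => inner ℝ (gradient f z) y) = fun z => fderiv ℝ f z y :=
    funext fun _ => inner_gradient_left
  have h1 := hf.differentiableAt_gradient.hasFDerivAt.inner ℝ (hasFDerivAt_const y c)
  have h2 := hd.hasFDerivAt.clm_apply (hasFDerivAt_const y c)
  rw [h] at h1
  simpa using DFunLike.congr_fun (h1.unique h2) x

theorem inner_fderiv_gradient_comm (hf : ContDiffAt ℝ 2 f c) (x y : E) :
    inner ℝ (fderiv ℝ (gradient f) c x) y = inner ℝ (fderiv ℝ (gradient f) c y) x := by
  rw [inner_fderiv_gradient hf, inner_fderiv_gradient hf]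
  exact (hf.isSymmSndFDerivAt (by simp)).eq x y

/-- Second order Taylor expansion at a critical point. -/
theorem isLittleO_sub_half_inner_fderiv_gradient (hf : ContDiffAt ℝ 2 f c)
    (hc : gradient f c = 0) :
    (fun x => f x - f c - 2⁻¹ * inner ℝ (fderiv ℝ (gradient f) c (x - c)) (x - c))
      =o[𝓝 c] fun x => ‖x - c‖ ^ 2 := by
  set H := fderiv ℝ (gradient f) c with hH
  rw [Asymptotics.isLittleO_iff]
  intro η hη
  have hgrad : ∀ᶠ x in 𝓝 c, ‖gradient f x - H (x - c)‖ ≤ η * ‖x - c‖ := by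
    have h := (hasFDerivAt_iff_isLittleO.1
      hf.differentiableAt_gradient.hasFDerivAt).def hη
    simpa only [hc, sub_zero] using h
  have hdiff : ∀ᶠ x in 𝓝 c, DifferentiableAt ℝ f x :=
    (hf.eventually (by simp)).mono fun x hx => hx.differentiableAt two_ne_zero
  obtain ⟨ρ, hρ, hball⟩ := Metric.eventually_nhds_iff_ball.1 (hgrad.and hdiff)
  filter_upwards [Metric.ball_mem_nhds c hρ] with x hx
  -- As `H` is symmetric, `g` has gradient `∇f(y) - H (y - c)`, of norm at most `η * ‖x - c‖` on the
  -- ball of radius `‖x - c‖`; the mean value inequality supplies the second factor.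
  set g : E → ℝ := fun y => f y - f c - 2⁻¹ * inner ℝ (H (y - c)) (y - c) with hg
  have hderiv : ∀ y ∈ Metric.closedBall c ‖x - c‖,
      HasFDerivWithinAt g (innerSL ℝ (gradient f y - H (y - c)))
        (Metric.closedBall c ‖x - c‖) y := by
    intro y hy
    have hyρ : y ∈ Metric.ball c ρ :=
      Metric.closedBall_subset_ball (by rwa [← dist_eq_norm]) hy
    have h1 := (hball y hyρ).2.hasGradientAt.hasFDerivAt
    have hsub : HasFDerivAt (fun y : E => y - c) (ContinuousLinearMap.id ℝ E) y :=
      (hasFDerivAt_id y).sub_const c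
    have h2 := ((H.hasFDerivAt.comp y hsub).inner ℝ hsub).const_mul (2⁻¹ : ℝ)
    refine (((h1.sub_const (f c)).sub h2).congr_fderiv ?_).hasFDerivWithinAt
    ext z
    have hsymm := inner_fderiv_gradient_comm hf (y - c) z
    rw [← hH] at hsymm
    simp only [sub_apply, smul_apply,
      ContinuousLinearMap.comp_apply, ContinuousLinearMap.prod_apply, fderivInnerCLM_apply,
      ContinuousLinearMap.id_apply, innerSL_apply_apply, inner_sub_left, Function.comp_apply,
      InnerProductSpace.toDual_apply_apply, smul_eq_mul, ← hsymm]
    ring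
  have hbound : ∀ y ∈ Metric.closedBall c ‖x - c‖,
      ‖innerSL ℝ (gradient f y - H (y - c))‖ ≤ η * ‖x - c‖ := by
    intro y hy
    have hyρ : y ∈ Metric.ball c ρ :=
      Metric.closedBall_subset_ball (by rwa [← dist_eq_norm]) hy
    rw [innerSL_apply_norm]
    refine (hball y hyρ).1.trans ?_
    gcongr
    rwa [← dist_eq_norm]
  have h := (convex_closedBall c ‖x - c‖).norm_image_sub_le_of_norm_hasFDerivWithin_le hderiv
    hbound (Metric.mem_closedBall_self (norm_nonneg _))
    (show x ∈ Metric.closedBall c ‖x - c‖ by simp [dist_eq_norm])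
  have hgc : g c = 0 := by simp [hg]
  rw [hgc, sub_zero] at h
  simpa [hg, pow_two, mul_assoc] using h

variable {γ : ℝ → E} {v : E}

omit [CompleteSpace E] in
theorem tendsto_of_tendsto_secant (hv : Tendsto (fun t : ℝ => t⁻¹ • (γ t - c)) (𝓝[>] 0) (𝓝 v)) :
    Tendsto γ (𝓝[>] 0) (𝓝 c) := by
  have ht : Tendsto (fun t : ℝ => t) (𝓝[>] 0) (𝓝 0) := nhdsWithin_le_nhds
  have h : Tendsto (fun t : ℝ => t • t⁻¹ • (γ t - c) + c) (𝓝[>] 0) (𝓝 c) := by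
    simpa using (ht.smul hv).add_const c
  refine h.congr' ?_
  filter_upwards [self_mem_nhdsWithin] with t ht
  rw [smul_inv_smul₀ (ne_of_gt ht), sub_add_cancel]

omit [CompleteSpace E] in
theorem tendsto_secant_of_hasFDerivAt {F : Type*} [NormedAddCommGroup F] [NormedSpace ℝ F]
    {g : E → F} {g' : E →L[ℝ] F} (hg : HasFDerivAt g g' c)
    (hv : Tendsto (fun t : ℝ => t⁻¹ • (γ t - c)) (𝓝[>] 0) (𝓝 v)) :
    Tendsto (fun t : ℝ => t⁻¹ • (g (γ t) - g c)) (𝓝[>] 0) (𝓝 (g' v)) := by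
  have hγ : Tendsto (fun t => γ t - c) (𝓝[>] 0) (𝓝 0) := by
    simpa using (tendsto_of_tendsto_secant hv).sub_const c
  have h := (hasFDerivWithinAt_univ.2 hg).lim (c := fun t : ℝ => t⁻¹) hγ
    (.of_forall fun _ => mem_univ _) hv
  simpa only [add_sub_cancel] using h

/-- Second order behaviour along a curve leaving a critical point with one-sided derivative `v`. -/
theorem tendsto_secondOrder_secant (hf : ContDiffAt ℝ 2 f c) (hc : gradient f c = 0)
    (hv : Tendsto (fun t : ℝ => t⁻¹ • (γ t - c)) (𝓝[>] 0) (𝓝 v)) :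
    Tendsto (fun t : ℝ => (f (γ t) - f c) / t ^ 2) (𝓝[>] 0)
      (𝓝 (2⁻¹ * inner ℝ (fderiv ℝ (gradient f) c v) v)) := by
  set H := fderiv ℝ (gradient f) c
  have hO : (fun t : ℝ => ‖γ t - c‖ ^ 2) =O[𝓝[>] 0] fun t : ℝ => t ^ 2 := by
    refine (Asymptotics.IsBigO.pow (g := fun t : ℝ => t) ?_ 2)
    have h1 := hv.isBigO_one ℝ
    have h2 := (Asymptotics.isBigO_refl (fun t : ℝ => t) (𝓝[>] 0)).smul h1
    refine (h2.norm_left.congr' ?_ ?_)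
    · filter_upwards [self_mem_nhdsWithin] with t ht
      rw [smul_inv_smul₀ (ne_of_gt ht)]
    · exact .of_forall fun t => by simp
  have hrem := (((isLittleO_sub_half_inner_fderiv_gradient hf hc).comp_tendsto
    (tendsto_of_tendsto_secant hv)).trans_isBigO hO).tendsto_div_nhds_zero
  have hquad : Tendsto (fun t : ℝ => 2⁻¹ * inner ℝ (H (t⁻¹ • (γ t - c))) (t⁻¹ • (γ t - c)))
      (𝓝[>] 0) (𝓝 (2⁻¹ * inner ℝ (H v) v)) :=
    (((H.continuous.tendsto v).comp hv).inner hv).const_mul _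
  have h := hrem.add hquad
  rw [zero_add] at h
  refine h.congr fun t => ?_
  simp only [Function.comp_apply, map_smul, real_inner_smul_left, real_inner_smul_right]
  ring

/-- If the gradient along the curve is radial, its one-sided derivative is an eigendirection of
the derivative of the gradient. -/
theorem fderiv_gradient_apply_eq_smul (hf : ContDiffAt ℝ 2 f c) (hc : gradient f c = 0)
    (hv : Tendsto (fun t : ℝ => t⁻¹ • (γ t - c)) (𝓝[>] 0) (𝓝 v)) (hv1 : ‖v‖ = 1)
    (hrad : ∀ᶠ t in 𝓝[>] 0, ∃ l : ℝ, gradient f (γ t) = l • (γ t - c)) :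
    fderiv ℝ (gradient f) c v = (inner ℝ (fderiv ℝ (gradient f) c v) v : ℝ) • v := by
  have hg := tendsto_secant_of_hasFDerivAt hf.differentiableAt_gradient.hasFDerivAt hv
  simp only [hc, sub_zero] at hg
  -- With `s` the secant and `g` the rescaled gradient, `⟪s, s⟫ g - ⟪g, s⟫ s` vanishes when `g` is a
  -- multiple of `s`, so convergence of the multiplier `l` is never needed.
  have hl := ((hv.inner (𝕜 := ℝ) hv).smul hg).sub ((hg.inner (𝕜 := ℝ) hv).smul hv)
  rw [real_inner_self_eq_norm_sq, hv1, one_pow, one_smul] at hl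
  refine sub_eq_zero.1 (tendsto_nhds_unique hl (tendsto_const_nhds.congr' ?_))
  filter_upwards [hrad] with t ⟨l, hl⟩
  rw [hl, smul_comm t⁻¹ l, real_inner_smul_left _ _ l]
  module

end SecondOrder

/-! ### The main theorem -/

theorem mainTheorem3 (S : OMinimalStructure) {d : ℕ}
    (U : Set (EuclideanSpace ℝ (Fin d))) (hU : IsOpen U)
    (f : EuclideanSpace ℝ (Fin d) → ℝ) (hf : ContDiffOn ℝ 2 f U)
    (hfdef : S.DefinableFunction U f)
    (c : EuclideanSpace ℝ (Fin d)) (hcU : c ∈ U) (hc : gradient f c = 0)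
    (ε : ℝ) (hε : 0 < ε)
    (γ : ℝ → EuclideanSpace ℝ (Fin d))
    (hγdef : S.DefinableCurve (Set.Ico 0 ε) γ)
    (hγ : IsTangencyArc U f c ε γ)
    (hγarc : ParameterizedByArcLength c ε γ) :
    ∃ v : EuclideanSpace ℝ (Fin d),
      HasDerivWithinAt γ v (Set.Ici 0) 0 ∧
      (∃ μ : ℝ, (hessian f c).HasEigenvector μ v) ∧
      (GivesMin U f c ε γ →
        ∃ μ : ℝ, IsLeast {ν : ℝ | (hessian f c).HasEigenvalue ν} μ ∧
          (hessian f c).HasEigenvector μ v) ∧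
      (GivesMax U f c ε γ →
        ∃ μ : ℝ, IsGreatest {ν : ℝ | (hessian f c).HasEigenvalue ν} μ ∧
          (hessian f c).HasEigenvector μ v) := by

  have hfc : ContDiffAt ℝ 2 f c := hf.contDiffAt (hU.mem_nhds hcU)
  have hnorm : ∀ t ∈ Ioo 0 ε, ‖t⁻¹ • (γ t - c)‖ = 1 := fun t ht => by
    rw [norm_smul, hγarc t ⟨ht.1.le, ht.2⟩, norm_inv, Real.norm_of_nonneg ht.1.le,
      inv_mul_cancel₀ ht.1.ne']
  have hIoo : Ioo 0 ε ∈ 𝓝[>] (0 : ℝ) := Ioo_mem_nhdsGT hε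
  obtain ⟨v, hv⟩ := hγdef.exists_tendsto_secant hε c fun t ht => (hnorm t ht).le
  have hv1 : ‖v‖ = 1 := tendsto_nhds_unique hv.norm
    (tendsto_const_nhds.congr' (eventually_of_mem hIoo fun t ht => (hnorm t ht).symm))
  have hv0 : v ≠ 0 := norm_ne_zero_iff.1 (hv1 ▸ one_ne_zero)
  have heig : (hessian f c).HasEigenvector (inner ℝ (fderiv ℝ (gradient f) c v) v) v :=
    Module.End.hasEigenvector_iff.2 ⟨Module.End.mem_eigenspace_iff.2
      (fderiv_gradient_apply_eq_smul hfc hc hv hv1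
        (eventually_of_mem hIoo fun t ht => (hγ.mem_tangencySet t ht).2.2)), hv0⟩
  have hlim := tendsto_secondOrder_secant hfc hc hv
  -- The competitor for `ν` is the ray from `c` along a unit eigenvector, which meets the sphere of
  -- radius `t` at time `t`.
  have hunit : ∀ ν, (hessian f c).HasEigenvalue ν → ∃ w : EuclideanSpace ℝ (Fin d),
      Tendsto (fun t : ℝ => (f (c + t • w) - f c) / t ^ 2) (𝓝[>] 0) (𝓝 (2⁻¹ * ν)) ∧
      ∀ᶠ t : ℝ in 𝓝[>] 0, t ∈ Ioo 0 ε ∧ c + t • w ∈ Metric.sphere c t ∩ U := by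
    intro ν hν
    obtain ⟨u, hu⟩ := hν.exists_hasEigenvector
    have hu0 : ‖u‖ ≠ 0 := norm_ne_zero_iff.2 hu.2
    have hw1 : ‖‖u‖⁻¹ • u‖ = 1 := by rw [norm_smul, norm_inv, norm_norm, inv_mul_cancel₀ hu0]
    have hHu : fderiv ℝ (gradient f) c u = ν • u := hu.apply_eq_smul
    have hin : inner ℝ (fderiv ℝ (gradient f) c (‖u‖⁻¹ • u)) (‖u‖⁻¹ • u) = ν := by
      rw [map_smul, hHu, smul_comm, real_inner_smul_left, real_inner_self_eq_norm_sq, hw1,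
        one_pow, mul_one]
    have hsec : Tendsto (fun t : ℝ => t⁻¹ • (c + t • ‖u‖⁻¹ • u - c)) (𝓝[>] 0)
        (𝓝 (‖u‖⁻¹ • u)) := by
      refine tendsto_const_nhds.congr' ?_
      filter_upwards [self_mem_nhdsWithin] with t ht
      rw [add_sub_cancel_left, inv_smul_smul₀ (ne_of_gt ht)]
    refine ⟨‖u‖⁻¹ • u, ?_, ?_⟩
    · have h := tendsto_secondOrder_secant hfc hc hsec
      rwa [hin] at h
    · filter_upwards [hIoo, tendsto_of_tendsto_secant hsec (hU.mem_nhds hcU)] with t ht htU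
      refine ⟨ht, ?_, htU⟩
      rw [mem_sphere_iff_norm, add_sub_cancel_left, norm_smul, hw1, mul_one,
        Real.norm_of_nonneg ht.1.le]
  refine ⟨v, ?_, ⟨_, heig⟩, fun hmin => ⟨_, ⟨Module.End.hasEigenvalue_of_hasEigenvector heig, fun ν hν => ?_⟩, heig⟩,
    fun hmax => ⟨_, ⟨Module.End.hasEigenvalue_of_hasEigenvector heig, fun ν hν => ?_⟩, heig⟩⟩
  · rw [← hasDerivWithinAt_Ioi_iff_Ici, hasDerivWithinAt_iff_tendsto_slope' self_notMem_Ioi]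
    simpa only [slope_fun_def, sub_zero, vsub_eq_sub, hγ.map_zero] using hv
  · obtain ⟨w, hw, hmem⟩ := hunit ν hν
    refine le_of_mul_le_mul_left (le_of_tendsto_of_tendsto hlim hw ?_) (by norm_num)
    filter_upwards [hmem] with t ht
    gcongr
    exact (hmin t ht.1).2 (mem_image_of_mem f ht.2)
  · obtain ⟨w, hw, hmem⟩ := hunit ν hν
    refine le_of_mul_le_mul_left (le_of_tendsto_of_tendsto hw hlim ?_) (by norm_num)
    filter_upwards [hmem] with t ht
    gcongr
    exact (hmax t ht.1).2 (mem_image_of_mem f ht.2)
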